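/- **Soundness and strong completeness of propositional intuitionistic dependence logic (PID).** *Language.* Formulas are built from propositional variables $p_i$ ($i\in\mathbb N$), $\bot$ and dependence atoms $=\!(p_{i_1},\dots,p_{i_k},p_j)$ ($k\ge 0$, arbitrary indices) by $\wedge,\vee,\to$. Put $\neg\varphi:=\varphi\to\bot$ and $\varphi\leftrightarrow\psi:=(\varphi\to\psi)\wedge(\psi\to\varphi)$. *Semantics.* A team is a set $X\subseteq\{0,1\}^{\mathbb N}$ of valuations. Truth on a team is defined by: - $X\models p_i$ iff $s(i)=1$ for all $s\in X$; - $X\models\bot$ iff $X=\emptyset$; - $X\models{=\!(p_{i_1},\dots,p_{i_k},p_j)}$ iff for all $s,s'\in X$, if $s(i_m)=s'(i_m)$ for $m=1,\dots,k$, then $s(j)=s'(j)$; - $X\models\varphi\wedge\psi$ iff $X\models\varphi$ and $X\models\psi$; - $X\models\varphi\vee\psi$ iff $X\models\varphi$ or $X\models\psi$; - $X\models\varphi\to\psi$ iff for every $Y\subseteq X$, $Y\models\varphi$ implies $Y\models\psi$. For a set $\Gamma$ of formulas, $\Gamma\models\varphi$ means that $X\models\varphi$ for every team $X$ with $X\models\gamma$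 for all $\gamma\in\Gamma$. *Hilbert system.* The axioms are, for arbitrary formulas $\varphi,\psi,\chi,\varphi_1,\dots,\varphi_k$ of the language and arbitrary indices $i,j,i_1,\dots,i_k\in\mathbb N$: 1. the axioms of intuitionistic propositional logic: $\varphi\to(\psi\to\varphi)$; $(\varphi\to(\psi\to\chi))\to((\varphi\to\psi)\to(\varphi\to\chi))$; $\varphi\wedge\psi\to\varphi$; $\varphi\wedge\psi\to\psi$; $\varphi\to(\psi\to\varphi\wedge\psi)$; $\varphi\to\varphi\vee\psi$; $\psi\to\varphi\vee\psi$; $(\varphi\to\chi)\to((\psi\to\chi)\to(\varphi\vee\psi\to\chi))$; $\bot\to\varphi$; 2. $\big(\neg\psi\to\bigvee_{1\le i\le k}\neg\varphi_i\big)\to\bigvee_{1\le i\le k}(\neg\psi\to\neg\varphi_i)$, for $k\ge1$; 3. $\neg\neg p_i\to p_i$ (for propositional variables only); 4. $=\!(p_i)\leftrightarrow(p_i\vee\neg p_i)$; 5. $=\!(p_{i_1},\dots,p_{i_k},p_j)\leftrightarrow\big((=\!(p_{i_1})\wedge\dots\wedge{=\!(p_{i_k})})\to{=\!(p_j)}\big)$,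 for $k\ge1$. The only rule is modus ponens: from $\varphi\to\psi$ and $\varphi$ infer $\psi$. Write $\Gamma\vdash\varphi$ if $\varphi$ is derivable from the axioms and members of $\Gamma$ by this rule. *Theorem.* For every set $\Gamma$ of formulas and every formula $\varphi$ (of this language), $$\Gamma\vdash\varphi\iff\Gamma\models\varphi.$$ -/

import Mathlib

/-!
Propositional intuitionistic dependence logic: language, team semantics, Hilbert system.
-/

namespace PID

/-- Formulas of the logic. The atom `dep [i₁, …, iₖ] j` is the dependence atom
`=(p_{i₁}, …, p_{iₖ}, p_j)`; for `k = 0` it is the constancy atom `=(p_j)`. -/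
inductive Formula : Type
  | var : ℕ → Formula
  | bot : Formula
  | dep : List ℕ → ℕ → Formula
  | and : Formula → Formula → Formula
  | or : Formula → Formula → Formula
  | imp : Formula → Formula → Formula

/-- A valuation is a function from the indices of the propositional variables to `{0, 1}`. -/
abbrev Valuation : Type := ℕ → Bool

/-- A team is an arbitrary set of valuations (possibly empty, possibly infinite). -/
abbrev Team : Type := Set Valuation

namespace Formula

/-- Negation abbreviates implication of falsum. -/
def neg (φ : Formula) : Formula := imp φ bot

/-- The biconditional abbreviates the conjunction of the two implications. -/
def iff (φ ψ : Formula) : Formula := and (imp φ ψ) (imp ψ φ)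

/-- The constancy atom `=(p_i)`. -/
def const (i : ℕ) : Formula := dep [] i

/-- Conjunction `φ ∧ (ψ₁ ∧ (ψ₂ ∧ …))` of the nonempty list with head `φ` and tail `[ψ₁, ψ₂, …]`. -/
def bigAnd : Formula → List Formula → Formula
  | φ, [] => φ
  | φ, ψ :: l => and φ (bigAnd ψ l)

/-- Disjunction `φ ∨ (ψ₁ ∨ (ψ₂ ∨ …))` of the nonempty list with head `φ` and tail `[ψ₁, ψ₂, …]`. -/
def bigOr : Formula → List Formula → Formula
  | φ, [] => φ
  | φ, ψ :: l => or φ (bigOr ψ l)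

/-- Team semantics: `φ.TrueOn X` says that `φ` is true on the team `X`. -/
def TrueOn : Formula → Team → Prop
  | var i, X => ∀ s ∈ X, s i = true
  | bot, X => X = ∅
  | dep is j, X => ∀ s ∈ X, ∀ s' ∈ X, (∀ i ∈ is, s i = s' i) → s j = s' j
  | and φ ψ, X => φ.TrueOn X ∧ ψ.TrueOn X
  | or φ ψ, X => φ.TrueOn X ∨ ψ.TrueOn X
  | imp φ ψ, X => ∀ Y : Team, Y ⊆ X → φ.TrueOn Y → ψ.TrueOn Y

end Formula

open Formula in
/-- The axioms of the Hilbert system. The letters `φ`, `ψ`, `χ`, `l` range over arbitrary formulas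
(and lists of formulas) of the language, so that the clauses for intuitionistic logic and for the
Maksimova formulas give all their substitution instances; the clauses `dne`, `const_iff` and
`dep_iff` are about propositional variables only. -/
inductive IsAx : Formula → Prop
  -- a standard list of axioms of intuitionistic propositional logic
  | imp_k (φ ψ : Formula) : IsAx (imp φ (imp ψ φ))
  | imp_s (φ ψ χ : Formula) :
      IsAx (imp (imp φ (imp ψ χ)) (imp (imp φ ψ) (imp φ χ)))
  | and_left (φ ψ : Formula) : IsAx (imp (and φ ψ) φ)
  | and_right (φ ψ : Formula) : IsAx (imp (and φ ψ) ψ)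
  | and_intro (φ ψ : Formula) : IsAx (imp φ (imp ψ (and φ ψ)))
  | or_left (φ ψ : Formula) : IsAx (imp φ (or φ ψ))
  | or_right (φ ψ : Formula) : IsAx (imp ψ (or φ ψ))
  | or_elim (φ ψ χ : Formula) :
      IsAx (imp (imp φ χ) (imp (imp ψ χ) (imp (or φ ψ) χ)))
  | ex_falso (φ : Formula) : IsAx (imp bot φ)
  -- Maksimova's `ND_k`, with `k = l.length + 1`: here `φ :: l` is the list `φ₁, …, φₖ`, and the
  -- formula is `(¬ψ → ⋁ᵢ ¬φᵢ) → ⋁ᵢ (¬ψ → ¬φᵢ)`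
  | nd (ψ φ : Formula) (l : List Formula) :
      IsAx (imp (imp (neg ψ) (bigOr (neg φ) (l.map neg)))
        (bigOr (imp (neg ψ) (neg φ)) (l.map fun χ => imp (neg ψ) (neg χ))))
  -- atomic double negation
  | dne (i : ℕ) : IsAx (imp (neg (neg (var i))) (var i))
  -- `=(p_i) ↔ (p_i ∨ ¬p_i)`
  | const_iff (i : ℕ) : IsAx (iff (const i) (or (var i) (neg (var i))))
  -- `=(p_{i₁}, …, p_{iₖ}, p_j) ↔ ((=(p_{i₁}) ∧ … ∧ =(p_{iₖ})) → =(p_j))`, with `k ≥ 1` and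
  -- `i :: is` the list `i₁, …, iₖ`
  | dep_iff (i : ℕ) (is : List ℕ) (j : ℕ) :
      IsAx (iff (dep (i :: is) j) (imp (bigAnd (const i) (is.map const)) (const j)))

/-- `Derives Γ φ`: there is a derivation of `φ` from hypotheses in `Γ`, with the axioms above and
modus ponens as the only rule. -/
inductive Derives (Γ : Set Formula) : Formula → Prop
  | hyp {φ : Formula} : φ ∈ Γ → Derives Γ φ
  | ax {φ : Formula} : IsAx φ → Derives Γ φ
  | mp {φ ψ : Formula} : Derives Γ (Formula.imp φ ψ) → Derives Γ φ → Derives Γ ψ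

/-- `Entails Γ φ`: the formula `φ` is true on every team on which all members of `Γ` are true. -/
def Entails (Γ : Set Formula) (φ : Formula) : Prop :=
  ∀ X : Team, (∀ γ ∈ Γ, γ.TrueOn X) → φ.TrueOn X

end PID

namespace PID

open Formula

/-! Soundness is an induction on derivations. For completeness, Lindenbaum's lemma extends `Γ` to a
prime theory `Δ` omitting `φ`, and it remains to find a team whose true formulas are exactly `Δ`.
Two facts give this. By `HasNegForm.mem`, on prime theories every formula amounts to a finite
disjunction of negations; the axioms `nd` and `dne` make this possible. By
`trueOn_canonicalTeam_neg_iff`, the canonical team satisfies exactly the negations in `Δ`, by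
reduction to classical valuations. The formulas true on a team themselves form a prime theory, so
the normal form carries the agreement from negations to all formulas. -/

theorem exists_mem_map_iff {α β : Type*} {f : α → β} {l : List α} {p : β → Prop} :
    (∃ b ∈ l.map f, p b) ↔ ∃ a ∈ l, p (f a) := by
  simp

/-! ### Team semantics -/

namespace Formula

theorem TrueOn.mono {φ : Formula} {X Y : Team} (h : φ.TrueOn X) (hYX : Y ⊆ X) : φ.TrueOn Y := by
  induction φ generalizing X Y with
  | var i => exact fun s hs => h s (hYX hs)
  | bot => exact Set.subset_eq_empty hYX h
  | dep is j => exact fun s hs s' hs' => h s (hYX hs) s' (hYX hs')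
  | and φ ψ ihφ ihψ => exact ⟨ihφ h.1 hYX, ihψ h.2 hYX⟩
  | or φ ψ ihφ ihψ => exact h.imp (ihφ · hYX) (ihψ · hYX)
  | imp φ ψ _ _ => exact fun Z hZ => h Z (hZ.trans hYX)

theorem trueOn_empty (φ : Formula) : φ.TrueOn ∅ := by
  induction φ with
  | var i => exact fun s hs => hs.elim
  | bot => rfl
  | dep is j => exact fun s hs => hs.elim
  | and φ ψ ihφ ihψ => exact ⟨ihφ, ihψ⟩
  | or φ ψ ihφ _ => exact Or.inl ihφ
  | imp φ ψ _ ihψ => exact fun Z hZ _ => Set.subset_empty_iff.1 hZ ▸ ihψ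

/-- By downward closure, a nonempty subteam satisfying `φ` contains a singleton satisfying `φ`;
hence negations are flat. -/
theorem trueOn_neg_iff {φ : Formula} {X : Team} :
    (neg φ).TrueOn X ↔ ∀ s ∈ X, ¬ φ.TrueOn {s} := by
  constructor
  · intro h s hs hφ
    exact Set.singleton_ne_empty s (h {s} (Set.singleton_subset_iff.2 hs) hφ)
  · intro h Y hY hφ
    refine Set.eq_empty_iff_forall_notMem.2 fun s hs => h s (hY hs) ?_
    exact hφ.mono (Set.singleton_subset_iff.2 hs)

theorem trueOn_imp_singleton_iff {φ ψ : Formula} {s : Valuation} :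
    (imp φ ψ).TrueOn {s} ↔ (φ.TrueOn {s} → ψ.TrueOn {s}) := by
  constructor
  · exact fun h => h {s} subset_rfl
  · intro h Y hY hφ
    rcases Set.subset_singleton_iff_eq.1 hY with rfl | rfl
    · exact ψ.trueOn_empty
    · exact h hφ

theorem trueOn_bigOr_iff {φ : Formula} {l : List Formula} {X : Team} :
    (bigOr φ l).TrueOn X ↔ ∃ χ ∈ φ :: l, χ.TrueOn X := by
  induction l generalizing φ with
  | nil => simp [bigOr]
  | cons ψ l ih => simp [bigOr, TrueOn, ih]

theorem trueOn_bigAnd_iff {φ : Formula} {l : List Formula} {X : Team} :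
    (bigAnd φ l).TrueOn X ↔ ∀ χ ∈ φ :: l, χ.TrueOn X := by
  induction l generalizing φ with
  | nil => simp [bigAnd]
  | cons ψ l ih => simp [bigAnd, TrueOn, ih]

theorem trueOn_const_iff {i : ℕ} {X : Team} :
    (const i).TrueOn X ↔ ∀ s ∈ X, ∀ s' ∈ X, s i = s' i := by
  simp [const, TrueOn]

theorem trueOn_bigAnd_const_iff {i : ℕ} {is : List ℕ} {X : Team} :
    (bigAnd (const i) (is.map const)).TrueOn X ↔
      ∀ k ∈ i :: is, ∀ s ∈ X, ∀ s' ∈ X, s k = s' k := by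
  simp only [trueOn_bigAnd_iff, ← List.map_cons, List.forall_mem_map, trueOn_const_iff]

theorem trueOn_iff_of_forall {φ ψ : Formula} (h : ∀ X, φ.TrueOn X ↔ ψ.TrueOn X) (X : Team) :
    (iff φ ψ).TrueOn X :=
  ⟨fun Y _ => (h Y).1, fun Y _ => (h Y).2⟩

theorem trueOn_const_iff_or_neg (i : ℕ) (X : Team) :
    (const i).TrueOn X ↔ (or (var i) (neg (var i))).TrueOn X := by
  rw [trueOn_const_iff]
  simp only [TrueOn, trueOn_neg_iff, Set.mem_singleton_iff, forall_eq]
  constructor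
  · intro h
    by_cases hX : ∃ s ∈ X, s i = true
    · obtain ⟨s, hs, hsi⟩ := hX
      exact Or.inl fun s' hs' => (h s' hs' s hs).trans hsi
    · exact Or.inr fun s hs hsi => hX ⟨s, hs, hsi⟩
  · rintro (h | h) s hs s' hs'
    · rw [h s hs, h s' hs']
    · rw [Bool.eq_false_of_not_eq_true (h s hs), Bool.eq_false_of_not_eq_true (h s' hs')]

theorem trueOn_dep_iff_imp (i : ℕ) (is : List ℕ) (j : ℕ) (X : Team) :
    (dep (i :: is) j).TrueOn X ↔
      (imp (bigAnd (const i) (is.map const)) (const j)).TrueOn X := by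
  constructor
  · intro h Y hY hc
    rw [trueOn_bigAnd_const_iff] at hc
    exact trueOn_const_iff.2 fun s hs s' hs' =>
      h s (hY hs) s' (hY hs') fun k hk => hc k hk s hs s' hs'
  · intro h s hs s' hs' hss'
    -- Two valuations agreeing on the antecedent variables form a subteam on which these are
    -- constant.
    refine trueOn_const_iff.1 (h {s, s'} (Set.pair_subset hs hs') ?_) s (by simp) s' (by simp)
    refine trueOn_bigAnd_const_iff.2 fun k hk t ht t' ht' => ?_
    have := hss' k hk
    rcases ht with rfl | rfl <;> rcases ht' with rfl | rfl <;> simp_all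

end Formula

theorem IsAx.trueOn {φ : Formula} (h : IsAx φ) (X : Team) : φ.TrueOn X := by
  induction h with
  | imp_k φ ψ => exact fun Y _ hφ Z hZ _ => hφ.mono hZ
  | imp_s φ ψ χ =>
    exact fun Y _ h₁ Z hZ h₂ W hW hφ =>
      h₁ W (hW.trans hZ) hφ W subset_rfl (h₂ W hW hφ)
  | and_left φ ψ => exact fun Y _ h => h.1
  | and_right φ ψ => exact fun Y _ h => h.2
  | and_intro φ ψ => exact fun Y _ hφ Z hZ hψ => ⟨hφ.mono hZ, hψ⟩
  | or_left φ ψ => exact fun Y _ => Or.inl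
  | or_right φ ψ => exact fun Y _ => Or.inr
  | or_elim φ ψ χ =>
    exact fun Y _ h₁ Z hZ h₂ W hW h => h.elim (h₁ W (hW.trans hZ)) (h₂ W hW)
  | ex_falso φ =>
    intro Y _ h
    obtain rfl : Y = ∅ := h
    exact φ.trueOn_empty
  | nd ψ φ l =>
    intro Y _ h
    -- This is the largest subteam of `Y` satisfying `neg ψ`, so the disjunct chosen here works for
    -- all smaller ones.
    have h' := h {s ∈ Y | ¬ ψ.TrueOn {s}} (Set.sep_subset _ _) (trueOn_neg_iff.2 fun s hs => hs.2)
    rw [trueOn_bigOr_iff, ← List.map_cons, exists_mem_map_iff] at h'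
    obtain ⟨χ, hχ, hχZ⟩ := h'
    refine trueOn_bigOr_iff.2 ⟨imp (neg ψ) (neg χ), ?_, fun W hW hψ => hχZ.mono fun s hs =>
      ⟨hW hs, trueOn_neg_iff.1 hψ s hs⟩⟩
    exact List.mem_map_of_mem (f := fun χ => imp (neg ψ) (neg χ)) hχ
  | dne i =>
    intro Y _ h s hs
    by_contra hsi
    exact trueOn_neg_iff.1 h s hs (trueOn_neg_iff.2 fun t ht => by simp_all [TrueOn])
  | const_iff i => exact trueOn_iff_of_forall (trueOn_const_iff_or_neg i) X
  | dep_iff i is j => exact trueOn_iff_of_forall (trueOn_dep_iff_imp i is j) X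

theorem Derives.entails {Γ : Set Formula} {φ : Formula} (h : Derives Γ φ) : Entails Γ φ := by
  intro X hX
  induction h with
  | hyp h => exact hX _ h
  | ax h => exact h.trueOn X
  | mp _ _ ih₁ ih₂ => exact ih₁ X subset_rfl ih₂

/-! ### Derivations -/

namespace Derives

variable {Γ Δ : Set Formula} {φ ψ χ : Formula}

theorem mono (h : Derives Γ φ) (hΓ : Γ ⊆ Δ) : Derives Δ φ := by
  induction h with
  | hyp h => exact .hyp (hΓ h)
  | ax h => exact .ax h
  | mp _ _ ih₁ ih₂ => exact ih₁.mp ih₂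

theorem imp_self (φ : Formula) : Derives Γ (imp φ φ) :=
  ((ax (.imp_s φ (imp φ φ) φ)).mp (ax (.imp_k _ _))).mp (ax (.imp_k _ _))

theorem weaken (h : Derives Γ φ) : Derives Γ (imp ψ φ) := (ax (.imp_k _ _)).mp h

theorem deduction (h : Derives (insert ψ Γ) φ) : Derives Γ (imp ψ φ) := by
  induction h with
  | hyp h =>
    rcases h with rfl | h
    · exact imp_self _
    · exact (hyp h).weaken
  | ax h => exact (ax h).weaken
  | mp _ _ ih₁ ih₂ => exact ((ax (.imp_s _ _ _)).mp ih₁).mp ih₂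

theorem ex_falso (h : Derives Γ bot) : Derives Γ φ := (ax (.ex_falso φ)).mp h

theorem exists_of_isChain {c : Set (Set Formula)} (hc : IsChain (· ⊆ ·) c) (hne : c.Nonempty)
    (h : Derives (⋃₀ c) φ) : ∃ Γ ∈ c, Derives Γ φ := by
  induction h with
  | hyp h =>
    obtain ⟨Γ, hΓ, h⟩ := h
    exact ⟨Γ, hΓ, hyp h⟩
  | ax h =>
    obtain ⟨Γ, hΓ⟩ := hne
    exact ⟨Γ, hΓ, ax h⟩
  | mp _ _ ih₁ ih₂ =>
    obtain ⟨Γ₁, h₁, d₁⟩ := ih₁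
    obtain ⟨Γ₂, h₂, d₂⟩ := ih₂
    rcases hc.total h₁ h₂ with h | h
    · exact ⟨Γ₂, h₂, (d₁.mono h).mp d₂⟩
    · exact ⟨Γ₁, h₁, d₁.mp (d₂.mono h)⟩

end Derives

/-! ### Prime theories -/

/-- A prime theory: a deductively closed set with the disjunction property. The set of all formulas
is allowed. -/
structure IsPrimeTheory (Δ : Set Formula) : Prop where
  closed {φ : Formula} : Derives Δ φ → φ ∈ Δ
  prime {φ ψ : Formula} : or φ ψ ∈ Δ → φ ∈ Δ ∨ ψ ∈ Δ

/-- Lindenbaum's lemma. -/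
theorem exists_isPrimeTheory {Γ : Set Formula} {φ : Formula} (h : ¬ Derives Γ φ) :
    ∃ Δ, IsPrimeTheory Δ ∧ Γ ⊆ Δ ∧ φ ∉ Δ ∧ ∀ ψ ∉ Δ, imp ψ φ ∈ Δ := by
  obtain ⟨Δ, hΓΔ, hΔ⟩ := zorn_subset_nonempty {Δ | ¬ Derives Δ φ}
    (fun c hc hchain hne => ⟨⋃₀ c, fun hd => by
      obtain ⟨Δ, hΔ, hd⟩ := hd.exists_of_isChain hchain hne
      exact hc hΔ hd, fun s hs => Set.subset_sUnion_of_mem hs⟩) Γ h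
  have key : ∀ ψ ∉ Δ, Derives Δ (imp ψ φ) := by
    intro ψ hψ
    by_contra hd
    exact hψ (hΔ.le_of_ge (y := insert ψ Δ) (fun h => hd h.deduction) (Set.subset_insert _ _)
      (Set.mem_insert _ _))
  have closed : ∀ {ψ}, Derives Δ ψ → ψ ∈ Δ := fun {ψ} hψ => by
    by_contra hn
    exact hΔ.prop ((key ψ hn).mp hψ)
  refine ⟨Δ, ⟨closed, fun {ψ χ} hor => ?_⟩, hΓΔ, fun hφ => hΔ.prop (.hyp hφ),
    fun ψ hψ => closed (key ψ hψ)⟩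
  by_contra! hn
  exact hΔ.prop ((((Derives.ax (.or_elim _ _ _)).mp (key ψ hn.1)).mp (key χ hn.2)).mp (.hyp hor))

/-- Disjunction is read on the whole team, hence primeness. This lets normal forms be evaluated on
teams. -/
theorem isPrimeTheory_trueOn (X : Team) : IsPrimeTheory {φ | φ.TrueOn X} where
  closed h := h.entails X fun _ => id
  prime h := h

namespace IsPrimeTheory

variable {Δ : Set Formula} {φ ψ χ : Formula}

theorem mp (hΔ : IsPrimeTheory Δ) (h : imp φ ψ ∈ Δ) (hφ : φ ∈ Δ) : ψ ∈ Δ :=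
  hΔ.closed ((Derives.hyp h).mp (.hyp hφ))

theorem mem_of_isAx (hΔ : IsPrimeTheory Δ) (h : IsAx φ) : φ ∈ Δ := hΔ.closed (.ax h)

theorem and_mem_iff (hΔ : IsPrimeTheory Δ) : and φ ψ ∈ Δ ↔ φ ∈ Δ ∧ ψ ∈ Δ :=
  ⟨fun h => ⟨hΔ.mp (hΔ.mem_of_isAx (.and_left _ _)) h, hΔ.mp (hΔ.mem_of_isAx (.and_right _ _)) h⟩,
    fun h => hΔ.mp (hΔ.mp (hΔ.mem_of_isAx (.and_intro _ _)) h.1) h.2⟩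

theorem or_mem_iff (hΔ : IsPrimeTheory Δ) : or φ ψ ∈ Δ ↔ φ ∈ Δ ∨ ψ ∈ Δ :=
  ⟨hΔ.prime, fun h => h.elim (hΔ.mp (hΔ.mem_of_isAx (.or_left _ _)))
    (hΔ.mp (hΔ.mem_of_isAx (.or_right _ _)))⟩

theorem bigOr_mem_iff (hΔ : IsPrimeTheory Δ) {l : List Formula} :
    bigOr φ l ∈ Δ ↔ ∃ χ ∈ φ :: l, χ ∈ Δ := by
  induction l generalizing φ with
  | nil => simp [bigOr]
  | cons ψ l ih => simp [bigOr, hΔ.or_mem_iff, ih]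

theorem imp_mem (hΔ : IsPrimeTheory Δ) (hψ : ψ ∈ Δ) : imp φ ψ ∈ Δ :=
  hΔ.closed (Derives.hyp hψ).weaken

theorem mem_of_bot_mem (hΔ : IsPrimeTheory Δ) (h : bot ∈ Δ) : φ ∈ Δ :=
  hΔ.closed (Derives.hyp h).ex_falso

theorem mem_iff_of_iff_mem (hΔ : IsPrimeTheory Δ) (h : iff φ ψ ∈ Δ) : φ ∈ Δ ↔ ψ ∈ Δ :=
  ⟨hΔ.mp (hΔ.and_mem_iff.1 h).1, hΔ.mp (hΔ.and_mem_iff.1 h).2⟩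

theorem const_mem_iff (hΔ : IsPrimeTheory Δ) {i : ℕ} :
    const i ∈ Δ ↔ var i ∈ Δ ∨ neg (var i) ∈ Δ :=
  (hΔ.mem_iff_of_iff_mem (hΔ.mem_of_isAx (.const_iff i))).trans hΔ.or_mem_iff

/-- The Kripke clause of the canonical model; it replaces formal derivations in later arguments. -/
theorem imp_mem_iff (hΔ : IsPrimeTheory Δ) :
    imp φ ψ ∈ Δ ↔ ∀ Δ', IsPrimeTheory Δ' → Δ ⊆ Δ' → φ ∈ Δ' → ψ ∈ Δ' := by
  refine ⟨fun h Δ' hΔ' hsub hφ => hΔ'.mp (hsub h) hφ, fun h => ?_⟩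
  by_contra hn
  obtain ⟨Δ', hΔ', hsub, hψ, -⟩ :=
    exists_isPrimeTheory (Γ := insert φ Δ) (φ := ψ) fun hd => hn (hΔ.closed hd.deduction)
  exact hψ (h Δ' hΔ' ((Set.subset_insert _ _).trans hsub) (hsub (Set.mem_insert _ _)))

theorem neg_neg_var_mem_iff (hΔ : IsPrimeTheory Δ) {i : ℕ} :
    neg (neg (var i)) ∈ Δ ↔ var i ∈ Δ :=
  ⟨hΔ.mp (hΔ.mem_of_isAx (.dne i)), fun h =>
    hΔ.imp_mem_iff.2 fun _ hΔ' hsub hn => hΔ'.mp hn (hsub h)⟩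

theorem neg_or_mem_iff (hΔ : IsPrimeTheory Δ) :
    neg (or φ ψ) ∈ Δ ↔ neg φ ∈ Δ ∧ neg ψ ∈ Δ := by
  simp only [neg, hΔ.imp_mem_iff]
  constructor
  · exact fun h => ⟨fun Δ' hΔ' hs hφ => h Δ' hΔ' hs (hΔ'.or_mem_iff.2 (.inl hφ)),
      fun Δ' hΔ' hs hψ => h Δ' hΔ' hs (hΔ'.or_mem_iff.2 (.inr hψ))⟩
  · exact fun h Δ' hΔ' hs ho => (hΔ'.or_mem_iff.1 ho).elim (h.1 Δ' hΔ' hs) (h.2 Δ' hΔ' hs)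

theorem neg_and_mem_iff (hΔ : IsPrimeTheory Δ) :
    neg (and φ ψ) ∈ Δ ↔ imp φ (neg ψ) ∈ Δ := by
  constructor
  · intro h
    exact hΔ.imp_mem_iff.2 fun Δ₁ h₁ hs₁ hφ => h₁.imp_mem_iff.2 fun Δ₂ h₂ hs₂ hψ =>
      h₂.mp (hs₂ (hs₁ h)) (h₂.and_mem_iff.2 ⟨hs₂ hφ, hψ⟩)
  · intro h
    exact hΔ.imp_mem_iff.2 fun Δ₁ h₁ hs₁ hand =>
      h₁.mp (h₁.mp (hs₁ h) (h₁.and_mem_iff.1 hand).1) (h₁.and_mem_iff.1 hand).2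

end IsPrimeTheory

theorem isPrimeTheory_univ : IsPrimeTheory Set.univ := ⟨fun _ => trivial, fun _ => .inl trivial⟩

/-! ### Disjunctions of negations -/

/-- `P` is expressed, on prime theories, by a finite disjunction of negations. -/
def HasNegForm (P : Set Formula → Prop) : Prop :=
  ∃ l : List Formula, ∀ Δ, IsPrimeTheory Δ → (P Δ ↔ ∃ a ∈ l, neg a ∈ Δ)

namespace HasNegForm

variable {P Q : Set Formula → Prop}

theorem congr (hP : HasNegForm P) (h : ∀ Δ, IsPrimeTheory Δ → (Q Δ ↔ P Δ)) : HasNegForm Q := by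
  obtain ⟨l, hl⟩ := hP
  exact ⟨l, fun Δ hΔ => (h Δ hΔ).trans (hl Δ hΔ)⟩

theorem neg_mem (a : Formula) : HasNegForm (neg a ∈ ·) := ⟨[a], by simp⟩

theorem or (hP : HasNegForm P) (hQ : HasNegForm Q) : HasNegForm fun Δ => P Δ ∨ Q Δ := by
  obtain ⟨l, hl⟩ := hP
  obtain ⟨m, hm⟩ := hQ
  exact ⟨l ++ m, fun Δ hΔ => by
    simp only [hl Δ hΔ, hm Δ hΔ, List.mem_append, or_and_right, exists_or]⟩

theorem and (hP : HasNegForm P) (hQ : HasNegForm Q) : HasNegForm fun Δ => P Δ ∧ Q Δ := by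
  obtain ⟨l, hl⟩ := hP
  obtain ⟨m, hm⟩ := hQ
  -- Distribute, then use that `¬a ∧ ¬b` is equivalent to `¬(a ∨ b)`.
  refine ⟨l.flatMap fun a => m.map (Formula.or a), fun Δ hΔ => ?_⟩
  refine (and_congr (hl Δ hΔ) (hm Δ hΔ)).trans ?_
  constructor
  · rintro ⟨⟨a, ha, haΔ⟩, b, hb, hbΔ⟩
    exact ⟨Formula.or a b, List.mem_flatMap.2 ⟨a, ha, List.mem_map_of_mem hb⟩,
      hΔ.neg_or_mem_iff.2 ⟨haΔ, hbΔ⟩⟩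
  · rintro ⟨c, hc, hcΔ⟩
    obtain ⟨a, ha, hc⟩ := List.mem_flatMap.1 hc
    obtain ⟨b, hb, rfl⟩ := List.mem_map.1 hc
    obtain ⟨haΔ, hbΔ⟩ := hΔ.neg_or_mem_iff.1 hcΔ
    exact ⟨⟨a, ha, haΔ⟩, b, hb, hbΔ⟩

theorem forall_mem {R : Formula → Set Formula → Prop} (hR : ∀ a, HasNegForm (R a))
    (l : List Formula) : HasNegForm fun Δ => ∀ a ∈ l, R a Δ := by
  induction l with
  | nil =>
    exact (neg_mem bot).congr fun Δ hΔ => by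
      simpa using show neg bot ∈ Δ from hΔ.closed (Derives.imp_self _)
  | cons a l ih => exact ((hR a).and ih).congr fun Δ _ => by simp

/-- Each `¬a → ¬b` is itself a negation, namely `¬(¬a ∧ b)`. -/
theorem exists_imp_neg_mem (a : Formula) (m : List Formula) :
    HasNegForm fun Δ => ∃ b ∈ m, imp (neg a) (neg b) ∈ Δ := by
  refine ⟨m.map (Formula.and (neg a)), fun Δ hΔ => ?_⟩
  simp only [exists_mem_map_iff, hΔ.neg_and_mem_iff]

end HasNegForm

/-- The axiom `nd` on prime theories. -/
theorem IsPrimeTheory.exists_imp_neg_mem {Δ : Set Formula} (hΔ : IsPrimeTheory Δ)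
    {a b : Formula} {m : List Formula}
    (h : ∀ Δ', IsPrimeTheory Δ' → Δ ⊆ Δ' → neg a ∈ Δ' → ∃ c ∈ b :: m, neg c ∈ Δ') :
    ∃ c ∈ b :: m, imp (neg a) (neg c) ∈ Δ := by
  have h₁ : imp (neg a) (bigOr (neg b) (m.map neg)) ∈ Δ := by
    refine hΔ.imp_mem_iff.2 fun Δ' hΔ' hs ha => ?_
    rw [hΔ'.bigOr_mem_iff, ← List.map_cons, exists_mem_map_iff]
    exact h Δ' hΔ' hs ha
  have h₂ := hΔ.mp (hΔ.mem_of_isAx (.nd a b m)) h₁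
  rwa [hΔ.bigOr_mem_iff, ← List.map_cons (f := fun χ => imp (neg a) (neg χ)),
    exists_mem_map_iff] at h₂

namespace HasNegForm

/-- An implication `⋁ ¬aᵢ → ⋁ ¬bⱼ` splits into the conjunction over `i` of `¬aᵢ → ⋁ ¬bⱼ`, and `nd`
moves each disjunction outside. -/
theorem imp_mem {φ ψ : Formula} (hφ : HasNegForm (φ ∈ ·)) (hψ : HasNegForm (ψ ∈ ·)) :
    HasNegForm (imp φ ψ ∈ ·) := by
  obtain ⟨l, hl⟩ := hφ
  obtain ⟨m, hm⟩ := hψ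
  refine (forall_mem (exists_imp_neg_mem · m) l).congr fun Δ hΔ => ?_
  constructor
  · intro h a ha
    rcases m with _ | ⟨b, m⟩
    -- An empty disjunction cannot represent `ψ`, since the improper theory contains `ψ`; so `nd` is
    -- needed only for `k ≥ 1`.
    · simpa using (hm _ isPrimeTheory_univ).1 trivial
    · exact hΔ.exists_imp_neg_mem fun Δ' hΔ' hs haΔ' =>
        (hm Δ' hΔ').1 (hΔ'.mp (hs h) ((hl Δ' hΔ').2 ⟨a, ha, haΔ'⟩))
  · intro h
    refine hΔ.imp_mem_iff.2 fun Δ' hΔ' hs hφ => (hm Δ' hΔ').2 ?_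
    obtain ⟨a, ha, haΔ'⟩ := (hl Δ' hΔ').1 hφ
    obtain ⟨b, hb, hab⟩ := h a ha
    exact ⟨b, hb, hΔ'.mp (hs hab) haΔ'⟩

theorem and_mem {φ ψ : Formula} (hφ : HasNegForm (φ ∈ ·)) (hψ : HasNegForm (ψ ∈ ·)) :
    HasNegForm (Formula.and φ ψ ∈ ·) :=
  (hφ.and hψ).congr fun _ hΔ => hΔ.and_mem_iff

theorem var_mem (i : ℕ) : HasNegForm (var i ∈ ·) :=
  (neg_mem (neg (var i))).congr fun _ hΔ => hΔ.neg_neg_var_mem_iff.symm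

theorem const_mem (i : ℕ) : HasNegForm (const i ∈ ·) :=
  ((var_mem i).or (neg_mem (var i))).congr fun _ hΔ => hΔ.const_mem_iff

theorem bigAnd_mem {φ : Formula} {l : List Formula} (h : ∀ χ ∈ φ :: l, HasNegForm (χ ∈ ·)) :
    HasNegForm (bigAnd φ l ∈ ·) := by
  induction l generalizing φ with
  | nil => exact h φ (by simp)
  | cons ψ l ih => exact (h φ (by simp)).and_mem (ih fun χ hχ => h χ (List.mem_cons_of_mem _ hχ))

theorem mem (φ : Formula) : HasNegForm (φ ∈ ·) := by
  induction φ with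
  | var i => exact var_mem i
  | bot =>
    exact (neg_mem (imp bot bot)).congr fun Δ hΔ =>
      ⟨hΔ.mem_of_bot_mem, fun h => hΔ.mp h (hΔ.closed (Derives.imp_self _))⟩
  | dep is j =>
    rcases is with _ | ⟨i, is⟩
    · exact const_mem j
    · refine (imp_mem (bigAnd_mem ?_) (const_mem j)).congr fun Δ hΔ =>
        hΔ.mem_iff_of_iff_mem (hΔ.mem_of_isAx (.dep_iff i is j))
      rw [← List.map_cons, List.forall_mem_map]
      exact fun k _ => const_mem k
  | and φ ψ ihφ ihψ => exact ihφ.and_mem ihψ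
  | or φ ψ ihφ ihψ => exact (ihφ.or ihψ).congr fun Δ hΔ => hΔ.or_mem_iff
  | imp φ ψ ihφ ihψ => exact ihφ.imp_mem ihψ

end HasNegForm

/-! ### Completeness -/

/-- Membership in a complete consistent theory is truth under a valuation. -/
theorem IsPrimeTheory.mem_iff_trueOn_singleton {M : Set Formula} (hM : IsPrimeTheory M)
    (hbot : bot ∉ M) (hneg : ∀ χ ∉ M, neg χ ∈ M) {s : Valuation}
    (hs : ∀ i, s i = true ↔ var i ∈ M) (φ : Formula) : φ ∈ M ↔ φ.TrueOn {s} := by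
  induction φ with
  | var i => simp [TrueOn, hs]
  | bot => simp [TrueOn, hbot]
  | dep is j =>
    -- `M` decides every variable, so it contains all constancy atoms, and with them all dependence
    -- atoms.
    have hj : const j ∈ M := hM.const_mem_iff.2 (or_iff_not_imp_left.2 (hneg _))
    refine iff_of_true ?_ (by simp [TrueOn])
    rcases is with _ | ⟨i, is⟩
    · exact hj
    · exact (hM.mem_iff_of_iff_mem (hM.mem_of_isAx (.dep_iff i is j))).2 (hM.imp_mem hj)
  | and φ ψ ihφ ihψ => rw [hM.and_mem_iff, ihφ, ihψ, TrueOn]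
  | or φ ψ ihφ ihψ => rw [hM.or_mem_iff, ihφ, ihψ, TrueOn]
  | imp φ ψ ihφ ihψ =>
    rw [trueOn_imp_singleton_iff, ← ihφ, ← ihψ]
    refine ⟨hM.mp, fun h => ?_⟩
    by_cases hφ : φ ∈ M
    · exact hM.imp_mem (h hφ)
    · exact hM.imp_mem_iff.2 fun Δ' hΔ' hsub hφ' =>
        hΔ'.mem_of_bot_mem (hΔ'.mp (hsub (hneg φ hφ)) hφ')

open Classical in
/-- Every formula consistent with a theory is satisfied by a valuation that satisfies the theory. -/
theorem exists_valuation {Δ : Set Formula} {ψ : Formula} (h : ¬ Derives Δ (neg ψ)) :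
    ∃ s : Valuation, (∀ χ ∈ Δ, χ.TrueOn {s}) ∧ ψ.TrueOn {s} := by
  obtain ⟨M, hM, hsub, hbot, hneg⟩ :=
    exists_isPrimeTheory (Γ := insert ψ Δ) (φ := bot) fun hd => h hd.deduction
  have key := hM.mem_iff_trueOn_singleton hbot hneg (s := fun i => decide (var i ∈ M)) (by simp)
  exact ⟨_, fun χ hχ => (key χ).1 (hsub (Set.mem_insert_of_mem _ hχ)),
    (key ψ).1 (hsub (Set.mem_insert _ _))⟩

/-- The canonical team of a set of formulas: the valuations that satisfy all its negations. -/
def canonicalTeam (Δ : Set Formula) : Team := {s | ∀ a, neg a ∈ Δ → ¬ a.TrueOn {s}}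

namespace IsPrimeTheory

variable {Δ : Set Formula}

/-- If `neg a` is not in `Δ`, then `a` is consistent with `Δ`, and `exists_valuation` yields a
member of the canonical team satisfying `a`. -/
theorem trueOn_canonicalTeam_neg_iff (hΔ : IsPrimeTheory Δ) {a : Formula} :
    (neg a).TrueOn (canonicalTeam Δ) ↔ neg a ∈ Δ := by
  rw [trueOn_neg_iff]
  refine ⟨fun h => ?_, fun h s hs => hs a h⟩
  by_contra hn
  obtain ⟨s, hs, ha⟩ := exists_valuation fun hd => hn (hΔ.closed hd)
  exact h s (fun b hb => trueOn_neg_iff.1 (hs _ hb) s rfl) ha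

theorem trueOn_canonicalTeam_iff (hΔ : IsPrimeTheory Δ) (φ : Formula) :
    φ.TrueOn (canonicalTeam Δ) ↔ φ ∈ Δ := by
  obtain ⟨l, hl⟩ := HasNegForm.mem φ
  refine (hl _ (isPrimeTheory_trueOn (canonicalTeam Δ))).trans (Iff.trans ?_ (hl Δ hΔ).symm)
  simp only [Set.mem_ofPred_eq, hΔ.trueOn_canonicalTeam_neg_iff]

end IsPrimeTheory

theorem Entails.derives {Γ : Set Formula} {φ : Formula} (h : Entails Γ φ) : Derives Γ φ := by
  by_contra hn
  obtain ⟨Δ, hΔ, hsub, hφ, -⟩ := exists_isPrimeTheory hn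
  exact hφ ((hΔ.trueOn_canonicalTeam_iff φ).1
    (h _ fun γ hγ => (hΔ.trueOn_canonicalTeam_iff γ).2 (hsub hγ)))

end PID

/-- Soundness and strong completeness of the Hilbert system of propositional intuitionistic
dependence logic with respect to team semantics. -/
theorem theorem4p4 (Γ : Set PID.Formula) (φ : PID.Formula) :
    PID.Derives Γ φ ↔ PID.Entails Γ φ :=
  ⟨PID.Derives.entails, PID.Entails.derives⟩
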